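/- **Theorem (Probability density function of the wrapped normal on the hypersphere).** Let $n\ge 1$, $K>0$, $R=1/\sqrt K$, and let $\mathbb S_K^n=\{x\in\mathbb R^{n+1}:\langle x,x\rangle=1/K\}$ with origin $\mu_0=(R,0,\dots,0)$. For $x,y\in\mathbb S^n_K$ with $y\ne -x$ and $v$ tangent at $x$ put $$\exp^K_x(v)=\cos\!\left(\tfrac{\|v\|}{R}\right)x+\sin\!\left(\tfrac{\|v\|}{R}\right)\frac{Rv}{\|v\|}\quad(\exp_x^K(0)=x),$$ $$\log^K_x(y)=\frac{\arccos\alpha}{\sqrt{1-\alpha^2}}\,(y-\alpha x),\quad \alpha=K\langle x,y\rangle\quad(\log^K_x(x)=0),$$ $$\mathrm{PT}^K_{x\to y}(v)=v-\frac{K\langle y,v\rangle}{1+K\langle x,y\rangle}(x+y).$$ Let $\mu\in\mathbb S_K^n$ with $\mu\neq-\mu_0$, let $\Sigma\in\mathbb R^{n\times n}$ be symmetric positive definite, identify $T_{\mu_0}\mathbb S_K^n=\{0\}\times\mathbb R^n$ with $\mathbb R^n$, let $\mathcal N(\cdot\,;0,\Sigma)$ be the density of the centred normal distribution there, and let $f=\exp^K_\mu\circ\mathrm{PT}^K_{\mu_0\to\mu}:T_{\mu_0}\mathbb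 S^n_K\to\mathbb S^n_K$ be the sampling map of the wrapped normal distribution. For $z\in\mathbb S_K^n\setminus\{-\mu\}$ put $u=\log^K_\mu(z)$, $v=\mathrm{PT}^K_{\mu\to\mu_0}(u)$, and define the wrapped normal density $$\mathcal{WN}(z;\mu,\Sigma)=\frac{\mathcal N(v;0,\Sigma)}{\left|\det\frac{\partial f}{\partial v}(v)\right|},$$ the determinant of $df_v:T_{\mu_0}\mathbb S_K^n\to T_z\mathbb S_K^n$ being taken in orthonormal bases. Then $\mathcal{WN}(z;\mu,\Sigma)>0$ and $$\log\mathcal{WN}(z;\mu,\Sigma)=\log\mathcal N(v;0,\Sigma)-(n-1)\log\left(\frac{R\left|\sin\left(\|u\|/R\right)\right|}{\|u\|}\right)$$ for all $z\in\mathbb S_K^n\setminus\{-\mu\}$, where for $z=\mu$ (that is, $u=0$) the fraction is read as its limit $1$. Moreover $\mathcal{WN}(\cdot\,;\mu,\Sigma)$ is the density, with respect to the Riemannian volume of $\mathbb S_K^n$, of the law of $f(v)$, $v\sim\mathcal N(0,\Sigma)$, on the event $\|v\|<\pi R$ on which $\log^K_\mu$ inverts $\exp^K_\mu$: for every Borel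 set $A\subseteq\mathbb S_K^n$, $$\mathbb P\big(f(v)\in A,\ \|v\|<\pi R\big)=\int_A\mathcal{WN}(z;\mu,\Sigma)\,d\mathrm{vol}(z).$$ -/

import Mathlib

open MeasureTheory ProbabilityTheory

noncomputable section

namespace WrappedNormal

/-- The radius `R = 1 / √K` of the hypersphere of curvature `K > 0`. -/
def radius (K : ℝ) : ℝ := 1 / √K

/-- The `n`-dimensional hypersphere of curvature `K`, `{x ∈ ℝⁿ⁺¹ : ⟨x, x⟩ = 1 / K}`. -/
def hypersphere (n : ℕ) (K : ℝ) : Set (EuclideanSpace ℝ (Fin (n + 1))) :=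
  {x | inner ℝ x x = 1 / K}

/-- The origin `μ₀ = (R, 0, …, 0)` of the hypersphere. -/
def origin (n : ℕ) (K : ℝ) : EuclideanSpace ℝ (Fin (n + 1)) :=
  EuclideanSpace.single 0 (radius K)

/-- The exponential map `exp_x(v) = cos(‖v‖ / R) x + sin(‖v‖ / R) R v / ‖v‖`, for `v` tangent at
`x`. At `v = 0` the second term vanishes, so that `exp_x(0) = x`. -/
def expMap {n : ℕ} (K : ℝ) (x v : EuclideanSpace ℝ (Fin (n + 1))) :
    EuclideanSpace ℝ (Fin (n + 1)) :=
  Real.cos (‖v‖ / radius K) • x + (Real.sin (‖v‖ / radius K) * (radius K / ‖v‖)) • v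

/-- The logarithmic map `log_x(y) = arccos α / √(1 - α²) (y - α x)` with `α = K ⟨x, y⟩`, for
`y ≠ -x`. At `y = x` it is `0`. -/
def logMap {n : ℕ} (K : ℝ) (x y : EuclideanSpace ℝ (Fin (n + 1))) :
    EuclideanSpace ℝ (Fin (n + 1)) :=
  (Real.arccos (K * inner ℝ x y) / √(1 - (K * inner ℝ x y) ^ 2)) • (y - (K * inner ℝ x y) • x)

/-- Parallel transport `PT_{x → y}(v) = v - K ⟨y, v⟩ / (1 + K ⟨x, y⟩) (x + y)` along the minimizing
geodesic, for `v` tangent at `x` and `y ≠ -x`. -/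
def transport {n : ℕ} (K : ℝ) (x y v : EuclideanSpace ℝ (Fin (n + 1))) :
    EuclideanSpace ℝ (Fin (n + 1)) :=
  v - (K * inner ℝ y v / (1 + K * inner ℝ x y)) • (x + y)

/-- The identification `(v₁, …, vₙ) ↦ (0, v₁, …, vₙ)` of `ℝⁿ` with the tangent space
`{v ∈ ℝⁿ⁺¹ : ⟨μ₀, v⟩ = 0}` at the origin `μ₀`. -/
def toTangent {n : ℕ} (v : EuclideanSpace ℝ (Fin n)) : EuclideanSpace ℝ (Fin (n + 1)) :=
  WithLp.toLp 2 (Fin.cons 0 (fun i => v i))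

/-- The coordinates in `ℝⁿ` of a vector tangent at the origin `μ₀` (inverse of `toTangent`). -/
def tangentCoords {n : ℕ} (v : EuclideanSpace ℝ (Fin (n + 1))) : EuclideanSpace ℝ (Fin n) :=
  WithLp.toLp 2 (fun i => v i.succ)

/-- The Lebesgue density `N(v; 0, Σ)` on `ℝⁿ` of the centred normal distribution with positive
definite covariance matrix `S = Σ`. -/
def normalDensity {n : ℕ} (S : Matrix (Fin n) (Fin n) ℝ) (v : EuclideanSpace ℝ (Fin n)) : ℝ :=
  (√((2 * Real.pi) ^ n * S.det))⁻¹ * Real.exp (-(v.ofLp ⬝ᵥ (S⁻¹).mulVec v.ofLp) / 2)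

/-- The sampling map `f = exp_μ ∘ PT_{μ₀ → μ}` on the tangent space at `μ₀`, in the coordinates
`ℝⁿ` of that space. -/
def wrap {n : ℕ} (K : ℝ) (μ : EuclideanSpace ℝ (Fin (n + 1))) (v : EuclideanSpace ℝ (Fin n)) :
    EuclideanSpace ℝ (Fin (n + 1)) :=
  expMap K μ (transport K (origin n K) μ (toTangent v))

/-- The vector `v = PT_{μ → μ₀}(log_μ(z))` tangent at `μ₀`, in the coordinates `ℝⁿ`. -/
def unwrap {n : ℕ} (K : ℝ) (μ z : EuclideanSpace ℝ (Fin (n + 1))) : EuclideanSpace ℝ (Fin n) :=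
  tangentCoords (transport K μ (origin n K) (logMap K μ z))

/-- The (absolute) Jacobian determinant `det (∂f / ∂v)` of the sampling map, as a map from the
tangent space at `μ₀` to the tangent space of the sphere at `f v`: the absolute value of the
determinant of the derivative in orthonormal bases of its domain and of its range. -/
def jacobian {n : ℕ} (K : ℝ) (μ : EuclideanSpace ℝ (Fin (n + 1))) (v : EuclideanSpace ℝ (Fin n)) :
    ℝ :=
  (fderiv ℝ (wrap K μ) v).toLinearMap.normDet

/-- The density `WN(z; μ, Σ) = N(v; 0, Σ) / det (∂f / ∂v)` at `v = PT_{μ → μ₀}(log_μ(z))` of the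
wrapped normal distribution. -/
def density {n : ℕ} (K : ℝ) (μ : EuclideanSpace ℝ (Fin (n + 1))) (S : Matrix (Fin n) (Fin n) ℝ)
    (z : EuclideanSpace ℝ (Fin (n + 1))) : ℝ :=
  normalDensity S (unwrap K μ z) / jacobian K μ (unwrap K μ z)

/-- The Riemannian volume (surface measure) of the hypersphere of curvature `K`, as a measure on the
ambient space `ℝⁿ⁺¹`: the surface measure of the unit sphere, scaled to radius `R`. -/
def surfaceMeasure (n : ℕ) (K : ℝ) : Measure (EuclideanSpace ℝ (Fin (n + 1))) :=
  ENNReal.ofReal (radius K ^ n) •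
    (volume : Measure (EuclideanSpace ℝ (Fin (n + 1)))).toSphere.map
      (fun x : Metric.sphere (0 : EuclideanSpace ℝ (Fin (n + 1))) 1 =>
        radius K • (x : EuclideanSpace ℝ (Fin (n + 1))))

/-- The law of `z = f v` for `v ∼ N(0, Σ)` on the event `‖v‖ < π R` on which the logarithmic map
inverts the sampling map. -/
def principalLaw {n : ℕ} (K : ℝ) (μ : EuclideanSpace ℝ (Fin (n + 1)))
    (S : Matrix (Fin n) (Fin n) ℝ) : Measure (EuclideanSpace ℝ (Fin (n + 1))) :=
  ((multivariateGaussian 0 S).restrict (Metric.ball 0 (Real.pi * radius K))).map (wrap K μ)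

end WrappedNormal

end

/-!
On the ball `‖v‖ < π R` the sampling map is
`f v = cos (‖v‖ / R) μ + sinc (‖v‖ / R) T v`, where `T` is parallel transport from the origin, a
linear isometry onto the tangent space at `μ` (`transportIsometry`). It is a bijection onto the
hypersphere without `-μ`, with inverse `unwrap` (`unwrap_wrap`, `wrap_unwrap`).

By the Gauss lemma (`inner_wrapDeriv`) its derivative at `v` is isometric along `v` and stretches
the orthogonal complement of `v` by `sinc (‖v‖ / R)`, so its Jacobian is
`sinc (‖v‖ / R) ^ (n - 1)` (`jacobian_eq`). As `‖v‖ = ‖u‖` and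
`sinc (‖u‖ / R) = R sin (‖u‖ / R) / ‖u‖ > 0`, this is the formula for the logarithm of the density;
the use of `sinc` makes `u = 0` an ordinary point.

For the law of `f v`, the surface measure is by definition a multiple of the Lebesgue measure of
solid cones. The solid cone over a set is, up to a null ray, the injective image of a cylinder in
`(0, 1) × ℝⁿ` under `(t, v) ↦ t f(v) / R`, a map whose Jacobian is `(t / R) ^ n` times that of `f`
because `f v` is orthogonal to the range of the derivative of `f` at `v` (`abs_det_coneDeriv`). The
change of variables formula in `ℝⁿ⁺¹` then shows that the surface measure is the image under `f` of
the measure with density `sinc (‖v‖ / R) ^ (n - 1)` on the ball (`surfaceMeasure_eq_map`). Together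
with the Lebesgue density of the normal distribution (`multivariateGaussian_eq_withDensity`) this
gives the density of the law of `f v`.
-/

namespace WrappedNormal

/-! ### Parallel transport on the hypersphere -/

section Geometry

variable {n : ℕ} {K : ℝ} {x y v : EuclideanSpace ℝ (Fin (n + 1))}

lemma radius_pos (hK : 0 < K) : 0 < radius K := by
  unfold radius; positivity

lemma radius_sq (hK : 0 < K) : radius K ^ 2 = 1 / K := by
  rw [radius, div_pow, one_pow, Real.sq_sqrt hK.le]

lemma norm_of_mem_hypersphere (hK : 0 < K) (hx : x ∈ hypersphere n K) : ‖x‖ = radius K := by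
  have h : inner ℝ x x = 1 / K := hx
  rw [real_inner_self_eq_norm_sq, ← radius_sq hK] at h
  exact (sq_eq_sq₀ (norm_nonneg _) (radius_pos hK).le).1 h

lemma mem_hypersphere_iff_norm (hK : 0 < K) : x ∈ hypersphere n K ↔ ‖x‖ = radius K := by
  refine ⟨norm_of_mem_hypersphere hK, fun h => ?_⟩
  change inner ℝ x x = 1 / K
  rw [real_inner_self_eq_norm_sq, h, radius_sq hK]

lemma origin_mem (hK : 0 < K) : origin n K ∈ hypersphere n K := by
  rw [mem_hypersphere_iff_norm hK]
  simp [origin, abs_of_pos (radius_pos hK)]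

lemma inner_origin (v : EuclideanSpace ℝ (Fin (n + 1))) :
    inner ℝ (origin n K) v = radius K * v 0 := by
  simp [origin, EuclideanSpace.inner_single_left]

lemma one_add_inner_pos (hK : 0 < K) (hx : x ∈ hypersphere n K) (hy : y ∈ hypersphere n K)
    (hxy : y ≠ -x) : 0 < 1 + K * inner ℝ x y := by
  have hne : x + y ≠ 0 := fun h => hxy (eq_neg_of_add_eq_zero_right h)
  have hpos : 0 < ‖x + y‖ ^ 2 := by positivity
  have hx' : inner ℝ x x = 1 / K := hx
  have hy' : inner ℝ y y = 1 / K := hy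
  rw [norm_add_sq_real, ← real_inner_self_eq_norm_sq, ← real_inner_self_eq_norm_sq, hx', hy'] at hpos
  have h := mul_pos hK hpos
  field_simp at h
  linarith

lemma transport_add (x y v w : EuclideanSpace ℝ (Fin (n + 1))) :
    transport K x y (v + w) = transport K x y v + transport K x y w := by
  simp only [transport, inner_add_right, mul_add, add_div, add_smul]
  abel

lemma transport_smul (x y : EuclideanSpace ℝ (Fin (n + 1))) (c : ℝ)
    (v : EuclideanSpace ℝ (Fin (n + 1))) :
    transport K x y (c • v) = c • transport K x y v := by
  simp only [transport, inner_smul_right, smul_sub, smul_smul]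
  congr 2
  ring

lemma inner_transport (hK : 0 < K) (hx : x ∈ hypersphere n K) (hy : y ∈ hypersphere n K)
    (hxy : y ≠ -x) : inner ℝ y (transport K x y v) = 0 := by
  have h := one_add_inner_pos hK hx hy hxy
  have hy' : inner ℝ y y = 1 / K := hy
  rw [transport, inner_sub_right, inner_smul_right, inner_add_right, hy', real_inner_comm x y]
  field_simp
  ring

lemma norm_transport (hK : 0 < K) (hx : x ∈ hypersphere n K) (hy : y ∈ hypersphere n K)
    (hxy : y ≠ -x) (hv : inner ℝ x v = 0) : ‖transport K x y v‖ = ‖v‖ := by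
  have h := one_add_inner_pos hK hx hy hxy
  have hx' : inner ℝ x x = 1 / K := hx
  have hy' : inner ℝ y y = 1 / K := hy
  refine (sq_eq_sq₀ (norm_nonneg _) (norm_nonneg _)).1 ?_
  rw [transport, norm_sub_sq_real, norm_smul, mul_pow, norm_add_sq_real, inner_smul_right,
    inner_add_right, real_inner_comm x v, hv, real_inner_comm y v,
    ← real_inner_self_eq_norm_sq x, ← real_inner_self_eq_norm_sq y, hx', hy', Real.norm_eq_abs,
    sq_abs]
  field_simp
  ring

/-- Transporting a tangent vector to `y` and back to `x` gives the vector back. -/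
lemma transport_transport (hK : 0 < K) (hx : x ∈ hypersphere n K) (hy : y ∈ hypersphere n K)
    (hxy : y ≠ -x) (hv : inner ℝ x v = 0) : transport K y x (transport K x y v) = v := by
  have h := one_add_inner_pos hK hx hy hxy
  have hx' : inner ℝ x x = 1 / K := hx
  have hin : inner ℝ x (transport K x y v) = -inner ℝ y v := by
    rw [transport, inner_sub_right, inner_smul_right, inner_add_right, hx', hv]
    field_simp
    ring
  rw [transport, hin, transport, real_inner_comm x y, add_comm y x, sub_sub, ← add_smul]
  have : K * inner ℝ y v / (1 + K * inner ℝ x y) + K * -inner ℝ y v / (1 + K * inner ℝ x y) = 0 := by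
    ring
  rw [this, zero_smul, sub_zero]

lemma toTangent_add (v w : EuclideanSpace ℝ (Fin n)) :
    toTangent (v + w) = toTangent v + toTangent w := by
  ext i; refine Fin.cases ?_ (fun i => ?_) i <;> simp [toTangent]

lemma toTangent_smul (c : ℝ) (v : EuclideanSpace ℝ (Fin n)) :
    toTangent (c • v) = c • toTangent v := by
  ext i; refine Fin.cases ?_ (fun i => ?_) i <;> simp [toTangent]

lemma inner_origin_toTangent (v : EuclideanSpace ℝ (Fin n)) :
    inner ℝ (origin n K) (toTangent v) = 0 := by
  rw [inner_origin]; simp [toTangent]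

lemma norm_toTangent (v : EuclideanSpace ℝ (Fin n)) : ‖toTangent v‖ = ‖v‖ := by
  rw [EuclideanSpace.norm_eq, EuclideanSpace.norm_eq, Fin.sum_univ_succ]
  simp [toTangent]

lemma tangentCoords_toTangent (v : EuclideanSpace ℝ (Fin n)) : tangentCoords (toTangent v) = v := by
  ext i; simp [tangentCoords, toTangent]

lemma toTangent_tangentCoords (hK : 0 < K) (hv : inner ℝ (origin n K) v = 0) :
    toTangent (tangentCoords v) = v := by
  rw [inner_origin] at hv
  have h0 : v 0 = 0 := by simpa [(radius_pos hK).ne'] using hv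
  ext i; refine Fin.cases ?_ (fun i => ?_) i <;> simp [tangentCoords, toTangent, h0]

/-- The parallel transport from the origin to `μ`, in the coordinates `ℝⁿ` of its domain, as a
linear isometry onto the tangent space at `μ`. -/
noncomputable def transportIsometry (hK : 0 < K) {μ : EuclideanSpace ℝ (Fin (n + 1))}
    (hμ : μ ∈ hypersphere n K) (hμ0 : μ ≠ -origin n K) :
    EuclideanSpace ℝ (Fin n) →ₗᵢ[ℝ] EuclideanSpace ℝ (Fin (n + 1)) where
  toFun v := transport K (origin n K) μ (toTangent v)
  map_add' v w := by rw [toTangent_add, transport_add]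
  map_smul' c v := by simp [toTangent_smul, transport_smul]
  norm_map' v := by
    change ‖transport K (origin n K) μ (toTangent v)‖ = ‖v‖
    rw [norm_transport hK (origin_mem hK) hμ hμ0 (inner_origin_toTangent v), norm_toTangent]

/-! ### The exponential and logarithmic maps -/

variable {μ z : EuclideanSpace ℝ (Fin (n + 1))}

lemma inner_transportIsometry (hK : 0 < K) (hμ : μ ∈ hypersphere n K) (hμ0 : μ ≠ -origin n K)
    (v : EuclideanSpace ℝ (Fin n)) : inner ℝ μ (transportIsometry hK hμ hμ0 v) = 0 :=
  inner_transport hK (origin_mem hK) hμ hμ0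

lemma expMap_eq_sinc (hK : 0 < K) (x v : EuclideanSpace ℝ (Fin (n + 1))) :
    expMap K x v =
      Real.cos (‖v‖ / radius K) • x + Real.sinc (‖v‖ / radius K) • v := by
  rcases eq_or_ne v 0 with rfl | hv
  · simp [expMap]
  · have hR := radius_pos hK
    have hv' : 0 < ‖v‖ := norm_pos_iff.2 hv
    rw [expMap, Real.sinc_of_ne_zero (by positivity)]
    congr 2
    field_simp

lemma wrap_eq_sinc (hK : 0 < K) (hμ : μ ∈ hypersphere n K) (hμ0 : μ ≠ -origin n K)
    (v : EuclideanSpace ℝ (Fin n)) :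
    wrap K μ v = Real.cos (‖v‖ / radius K) • μ +
      Real.sinc (‖v‖ / radius K) • transportIsometry hK hμ hμ0 v := by
  rw [← (transportIsometry hK hμ hμ0).norm_map v]
  exact expMap_eq_sinc hK _ _

lemma mul_sinc (t : ℝ) : t * Real.sinc t = Real.sin t := by
  rcases eq_or_ne t 0 with rfl | h
  · simp
  · rw [Real.sinc_of_ne_zero h]; field_simp

lemma sinc_pos {t : ℝ} (h0 : 0 ≤ t) (h : t < Real.pi) : 0 < Real.sinc t := by
  rcases h0.eq_or_lt with rfl | h0
  · simp
  · rw [Real.sinc_of_ne_zero h0.ne']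
    exact div_pos (Real.sin_pos_of_pos_of_lt_pi h0 h) h0

lemma inner_expMap (hK : 0 < K) (hx : x ∈ hypersphere n K) (hv : inner ℝ x v = 0) :
    K * inner ℝ x (expMap K x v) = Real.cos (‖v‖ / radius K) := by
  have hx' : inner ℝ x x = 1 / K := hx
  rw [expMap_eq_sinc hK, inner_add_right, inner_smul_right, inner_smul_right, hv, hx']
  field_simp
  ring

lemma expMap_mem (hK : 0 < K) (hx : x ∈ hypersphere n K) (hv : inner ℝ x v = 0) :
    expMap K x v ∈ hypersphere n K := by
  have hR := radius_pos hK
  rw [mem_hypersphere_iff_norm hK]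
  refine (sq_eq_sq₀ (norm_nonneg _) hR.le).1 ?_
  have hs : Real.sinc (‖v‖ / radius K) * ‖v‖ = radius K * Real.sin (‖v‖ / radius K) := by
    rw [← mul_sinc]; field_simp
  rw [expMap_eq_sinc hK, norm_add_sq_real, inner_smul_left, inner_smul_right, hv, norm_smul,
    norm_smul, mul_pow, mul_pow, norm_of_mem_hypersphere hK hx, Real.norm_eq_abs, Real.norm_eq_abs,
    sq_abs, sq_abs, ← mul_pow _ ‖v‖, hs]
  linear_combination radius K ^ 2 * Real.sin_sq_add_cos_sq (‖v‖ / radius K)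

lemma mul_inner_self (hK : 0 < K) (hx : x ∈ hypersphere n K) : K * inner ℝ x x = 1 := by
  rw [show inner ℝ x x = 1 / K from hx]
  field_simp

lemma logMap_self (hK : 0 < K) (hx : x ∈ hypersphere n K) : logMap K x x = 0 := by
  rw [logMap, mul_inner_self hK hx, one_smul, sub_self, smul_zero]

lemma expMap_zero (x : EuclideanSpace ℝ (Fin (n + 1))) : expMap K x 0 = x := by
  simp [expMap]

lemma logMap_expMap (hK : 0 < K) (hx : x ∈ hypersphere n K) (hv : inner ℝ x v = 0)
    (hlt : ‖v‖ < Real.pi * radius K) : logMap K x (expMap K x v) = v := by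
  have hR := radius_pos hK
  rcases eq_or_ne v 0 with rfl | hv0
  · rw [expMap_zero, logMap_self hK hx]
  have ht : 0 < ‖v‖ / radius K := div_pos (norm_pos_iff.2 hv0) hR
  have htpi : ‖v‖ / radius K < Real.pi := (div_lt_iff₀ hR).2 hlt
  have hsin := Real.sin_pos_of_pos_of_lt_pi ht htpi
  rw [logMap, inner_expMap hK hx hv, Real.arccos_cos ht.le htpi.le, expMap_eq_sinc hK,
    add_sub_cancel_left, ← Real.sin_sq, Real.sqrt_sq hsin.le, smul_smul, div_mul_eq_mul_div,
    mul_sinc, div_self hsin.ne', one_smul]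

lemma inner_logMap (hK : 0 < K) (hx : x ∈ hypersphere n K) (z : EuclideanSpace ℝ (Fin (n + 1))) :
    inner ℝ x (logMap K x z) = 0 := by
  have hx' : inner ℝ x x = 1 / K := hx
  rw [logMap, inner_smul_right, inner_sub_right, inner_smul_right, hx']
  field_simp
  ring

lemma mul_inner_le_one (hK : 0 < K) (hx : x ∈ hypersphere n K) (hz : z ∈ hypersphere n K) :
    K * inner ℝ x z ≤ 1 := by
  have h := real_inner_le_norm x z
  rw [norm_of_mem_hypersphere hK hx, norm_of_mem_hypersphere hK hz, ← sq, radius_sq hK] at h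
  calc K * inner ℝ x z ≤ K * (1 / K) := by gcongr
    _ = 1 := by field_simp

lemma sq_norm_sub_smul (hK : 0 < K) (hx : x ∈ hypersphere n K) (hz : z ∈ hypersphere n K) :
    ‖z - (K * inner ℝ x z) • x‖ ^ 2 = (1 - (K * inner ℝ x z) ^ 2) * radius K ^ 2 := by
  rw [norm_sub_sq_real, norm_smul, mul_pow, norm_of_mem_hypersphere hK hx,
    norm_of_mem_hypersphere hK hz, inner_smul_right, real_inner_comm x z, Real.norm_eq_abs, sq_abs,
    radius_sq hK]
  field_simp
  ring

lemma eq_of_mul_inner_eq_one (hK : 0 < K) (hx : x ∈ hypersphere n K) (hz : z ∈ hypersphere n K)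
    (h : K * inner ℝ x z = 1) : z = x := by
  have := sq_norm_sub_smul hK hx hz
  simpa [h, sub_eq_zero] using this

lemma norm_logMap (hK : 0 < K) (hx : x ∈ hypersphere n K) (hz : z ∈ hypersphere n K)
    (hzx : z ≠ -x) : ‖logMap K x z‖ = Real.arccos (K * inner ℝ x z) * radius K := by
  rcases eq_or_ne z x with rfl | hne
  · rw [logMap_self hK hx, mul_inner_self hK hx, norm_zero, Real.arccos_one, zero_mul]
  have h1 := one_add_inner_pos hK hx hz hzx
  have h2 : K * inner ℝ x z < 1 :=
    lt_of_le_of_ne (mul_inner_le_one hK hx hz) fun h => hne (eq_of_mul_inner_eq_one hK hx hz h)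
  have hpos : 0 < 1 - (K * inner ℝ x z) ^ 2 := by nlinarith
  have hn : ‖z - (K * inner ℝ x z) • x‖ = √(1 - (K * inner ℝ x z) ^ 2) * radius K := by
    refine (sq_eq_sq₀ (norm_nonneg _) (mul_nonneg (Real.sqrt_nonneg _) (radius_pos hK).le)).1 ?_
    rw [sq_norm_sub_smul hK hx hz, mul_pow (√_), Real.sq_sqrt hpos.le]
  have hs := Real.sqrt_pos.2 hpos
  rw [logMap, norm_smul, hn, Real.norm_of_nonneg (div_nonneg (Real.arccos_nonneg _) hs.le),
    ← mul_assoc, div_mul_cancel₀ _ hs.ne']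

lemma expMap_logMap (hK : 0 < K) (hx : x ∈ hypersphere n K) (hz : z ∈ hypersphere n K)
    (hzx : z ≠ -x) : expMap K x (logMap K x z) = z := by
  have h1 := one_add_inner_pos hK hx hz hzx
  have hle := mul_inner_le_one hK hx hz
  rcases eq_or_ne z x with rfl | hne
  · rw [logMap_self hK hx, expMap_zero]
  have h2 : K * inner ℝ x z < 1 :=
    lt_of_le_of_ne hle fun h => hne (eq_of_mul_inner_eq_one hK hx hz h)
  have hs : 0 < √(1 - (K * inner ℝ x z) ^ 2) := Real.sqrt_pos.2 (by nlinarith)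
  have hR := radius_pos hK
  rw [expMap_eq_sinc hK, norm_logMap hK hx hz hzx, mul_div_cancel_right₀ _ hR.ne',
    Real.cos_arccos (by linarith) hle, logMap, smul_smul, mul_div_assoc', mul_comm (Real.sinc _),
    mul_sinc, Real.sin_arccos, div_self hs.ne', one_smul, add_sub_cancel]

lemma neg_origin_ne (hμ0 : μ ≠ -origin n K) : origin n K ≠ -μ := fun h => hμ0 (by rw [h, neg_neg])

/-- On the ball of radius `π R`, `unwrap` is a left inverse of the sampling map. -/
lemma unwrap_wrap (hK : 0 < K) (hμ : μ ∈ hypersphere n K) (hμ0 : μ ≠ -origin n K)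
    {v : EuclideanSpace ℝ (Fin n)} (hv : ‖v‖ < Real.pi * radius K) :
    unwrap K μ (wrap K μ v) = v := by
  have hT := (transportIsometry hK hμ hμ0).norm_map v
  have hlog : logMap K μ (wrap K μ v) = transportIsometry hK hμ hμ0 v :=
    logMap_expMap hK hμ (inner_transportIsometry hK hμ hμ0 v) (hT.trans_lt hv)
  rw [unwrap, hlog]
  change tangentCoords (transport K μ _ (transport K _ μ (toTangent v))) = v
  rw [transport_transport hK (origin_mem hK) hμ hμ0 (inner_origin_toTangent v),
    tangentCoords_toTangent]

lemma toTangent_unwrap (hK : 0 < K) (hμ : μ ∈ hypersphere n K) (hμ0 : μ ≠ -origin n K) :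
    toTangent (unwrap K μ z) = transport K μ (origin n K) (logMap K μ z) :=
  toTangent_tangentCoords hK (inner_transport hK hμ (origin_mem hK) (neg_origin_ne hμ0))

lemma wrap_unwrap (hK : 0 < K) (hμ : μ ∈ hypersphere n K) (hμ0 : μ ≠ -origin n K)
    (hz : z ∈ hypersphere n K) (hzμ : z ≠ -μ) : wrap K μ (unwrap K μ z) = z := by
  rw [wrap, toTangent_unwrap hK hμ hμ0,
    transport_transport hK hμ (origin_mem hK) (neg_origin_ne hμ0) (inner_logMap hK hμ z),
    expMap_logMap hK hμ hz hzμ]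

lemma norm_unwrap (hK : 0 < K) (hμ : μ ∈ hypersphere n K) (hμ0 : μ ≠ -origin n K) :
    ‖unwrap K μ z‖ = ‖logMap K μ z‖ := by
  rw [← norm_toTangent, toTangent_unwrap hK hμ hμ0,
    norm_transport hK hμ (origin_mem hK) (neg_origin_ne hμ0) (inner_logMap hK hμ z)]

lemma norm_unwrap_lt (hK : 0 < K) (hμ : μ ∈ hypersphere n K) (hμ0 : μ ≠ -origin n K)
    (hz : z ∈ hypersphere n K) (hzμ : z ≠ -μ) : ‖unwrap K μ z‖ < Real.pi * radius K := by
  rw [norm_unwrap hK hμ hμ0, norm_logMap hK hμ hz hzμ]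
  refine mul_lt_mul_of_pos_right (lt_of_le_of_ne (Real.arccos_le_pi _) fun h => ?_) (radius_pos hK)
  have := one_add_inner_pos hK hμ hz hzμ
  rw [Real.arccos_eq_pi] at h
  linarith

lemma wrap_mem (hK : 0 < K) (hμ : μ ∈ hypersphere n K) (hμ0 : μ ≠ -origin n K)
    (v : EuclideanSpace ℝ (Fin n)) : wrap K μ v ∈ hypersphere n K :=
  expMap_mem hK hμ (inner_transportIsometry hK hμ hμ0 v)

lemma wrap_ne_neg (hK : 0 < K) (hμ : μ ∈ hypersphere n K) (hμ0 : μ ≠ -origin n K)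
    {v : EuclideanSpace ℝ (Fin n)} (hv : ‖v‖ < Real.pi * radius K) : wrap K μ v ≠ -μ := by
  intro h
  have hR := radius_pos hK
  have hc := inner_expMap hK hμ (inner_transportIsometry hK hμ hμ0 v)
  rw [(transportIsometry hK hμ hμ0).norm_map] at hc
  have ha : K * inner ℝ μ (wrap K μ v) = -1 := by
    rw [h, inner_neg_right, show inner ℝ μ μ = 1 / K from hμ]; field_simp
  have hlt : Real.cos Real.pi < Real.cos (‖v‖ / radius K) :=
    Real.cos_lt_cos_of_nonneg_of_le_pi (by positivity) le_rfl ((div_lt_iff₀ hR).2 hv)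
  rw [Real.cos_pi, ← hc] at hlt
  exact hlt.ne ha.symm

end Geometry

end WrappedNormal

namespace WrappedNormal

/-! ### Jacobian of the sampling map -/

section Derivative

variable {n : ℕ}

/-- The determinant of a map that stretches the direction of `v` by `1` and its orthogonal
complement by `a`: the Gram matrix `a² I + c v vᵀ` with `a² + c ‖v‖² = 1` has determinant
`a ^ (2 n) (1 + c ‖v‖² / a²) = a ^ (2 (n - 1))`. -/
lemma normDet_eq_pow {V : Type*} [NormedAddCommGroup V] [InnerProductSpace ℝ V] (hn : 1 ≤ n)
    (f : EuclideanSpace ℝ (Fin n) →ₗ[ℝ] V) {a c : ℝ} (ha : 0 < a) (v : EuclideanSpace ℝ (Fin n))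
    (hc : a ^ 2 + c * ‖v‖ ^ 2 = 1)
    (hf : ∀ h k, inner ℝ (f h) (f k) = a ^ 2 * inner ℝ h k + c * (inner ℝ v h * inner ℝ v k)) :
    f.normDet = a ^ (n - 1) := by
  have hgram : Matrix.gram ℝ (f <| EuclideanSpace.basisFun (Fin n) ℝ ·) =
      (a ^ 2) • (1 + Matrix.replicateCol Unit ((c / a ^ 2) • v.ofLp) *
        Matrix.replicateRow Unit v.ofLp) := by
    ext i j
    simp only [Matrix.gram_apply, hf]
    simp only [EuclideanSpace.basisFun_apply, EuclideanSpace.inner_single_right,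
      Matrix.smul_apply, Matrix.add_apply, Matrix.mul_apply, Matrix.one_apply]
    simp [mul_add, eq_comm]
    field_simp
  have hsq : f.normDet ^ 2 = (a ^ (n - 1)) ^ 2 := by
    have h := f.normDet_sq_eq_det_gram (EuclideanSpace.basisFun (Fin n) ℝ)
    rw [hgram, Matrix.det_smul, Matrix.det_one_add_replicateCol_mul_replicateRow] at h
    have hdot : v.ofLp ⬝ᵥ ((c / a ^ 2) • v.ofLp) = c / a ^ 2 * ‖v‖ ^ 2 := by
      rw [dotProduct_smul, smul_eq_mul, EuclideanSpace.real_norm_sq_eq]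
      simp [dotProduct, sq]
    rw [hdot, show 1 + c / a ^ 2 * ‖v‖ ^ 2 = 1 / a ^ 2 by field_simp; exact hc] at h
    obtain ⟨m, rfl⟩ : ∃ m, n = m + 1 := ⟨n - 1, by omega⟩
    simp only [RCLike.ofReal_real_eq_id, id, Fintype.card_fin] at h
    rw [h, Nat.add_sub_cancel]
    field_simp
    ring
  exact (sq_eq_sq₀ f.normDet_nonneg (by positivity)).1 hsq

variable {K : ℝ} {μ : EuclideanSpace ℝ (Fin (n + 1))}

/-- The derivative of the sampling map at `v`: on the orthogonal complement of `v` it is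
`sinc (‖v‖ / R)` times the parallel transport, and along `v` it is the velocity of the geodesic.
At `v = 0` the last summand vanishes whatever the value of `(cos 0 - sinc 0) / 0 ^ 2` is. -/
noncomputable def wrapDeriv (hK : 0 < K) (hμ : μ ∈ hypersphere n K) (hμ0 : μ ≠ -origin n K)
    (v : EuclideanSpace ℝ (Fin n)) :
    EuclideanSpace ℝ (Fin n) →L[ℝ] EuclideanSpace ℝ (Fin (n + 1)) :=
  Real.sinc (‖v‖ / radius K) • (transportIsometry hK hμ hμ0).toContinuousLinearMap +
    (innerSL ℝ v).smulRight
      (((Real.cos (‖v‖ / radius K) - Real.sinc (‖v‖ / radius K)) / ‖v‖ ^ 2) •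
          transportIsometry hK hμ hμ0 v -
        (Real.sinc (‖v‖ / radius K) / radius K ^ 2) • μ)

lemma wrapDeriv_apply (hK : 0 < K) (hμ : μ ∈ hypersphere n K) (hμ0 : μ ≠ -origin n K)
    (v h : EuclideanSpace ℝ (Fin n)) :
    wrapDeriv hK hμ hμ0 v h = Real.sinc (‖v‖ / radius K) • transportIsometry hK hμ hμ0 h +
      inner ℝ v h • (((Real.cos (‖v‖ / radius K) - Real.sinc (‖v‖ / radius K)) / ‖v‖ ^ 2) •
          transportIsometry hK hμ hμ0 v -
        (Real.sinc (‖v‖ / radius K) / radius K ^ 2) • μ) := rfl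

lemma hasFDerivAt_norm {E : Type*} [NormedAddCommGroup E] [InnerProductSpace ℝ E] {v : E}
    (hv : v ≠ 0) : HasFDerivAt (fun v : E => ‖v‖) ((1 / ‖v‖) • innerSL ℝ v) v := by
  have h := (hasStrictFDerivAt_norm_sq v).hasFDerivAt.sqrt (pow_ne_zero 2 (norm_ne_zero_iff.2 hv))
  simp only [Real.sqrt_sq (norm_nonneg _)] at h
  convert h using 1
  ext w
  simp
  field_simp

lemma hasDerivAt_sinc {t : ℝ} (ht : t ≠ 0) :
    HasDerivAt Real.sinc ((Real.cos t - Real.sinc t) / t) t := by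
  have h := (Real.hasDerivAt_sin t).div (hasDerivAt_id t) ht
  refine (h.congr_of_eventuallyEq ?_).congr_deriv ?_
  · filter_upwards [isOpen_ne.mem_nhds ht] with s hs
    simp [Real.sinc_of_ne_zero hs]
  · rw [Real.sinc_of_ne_zero ht]
    simp only [id]
    field_simp

lemma hasFDerivAt_wrap (hK : 0 < K) (hμ : μ ∈ hypersphere n K) (hμ0 : μ ≠ -origin n K)
    (v : EuclideanSpace ℝ (Fin n)) : HasFDerivAt (wrap K μ) (wrapDeriv hK hμ hμ0 v) v := by
  have hR := radius_pos hK
  rw [show wrap K μ = fun v => Real.cos (‖v‖ / radius K) • μ +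
    Real.sinc (‖v‖ / radius K) • transportIsometry hK hμ hμ0 v from
    funext (wrap_eq_sinc hK hμ hμ0)]
  set T := transportIsometry hK hμ hμ0
  rcases eq_or_ne v 0 with rfl | hv
  · have hcos : HasFDerivAt (fun v : EuclideanSpace ℝ (Fin n) => Real.cos (‖v‖ / radius K))
        (0 : EuclideanSpace ℝ (Fin n) →L[ℝ] ℝ) 0 := by
      -- `0 ≤ 1 - cos t ≤ t² / 2`, so the cosine is stationary although the norm is not smooth at `0`
      rw [hasFDerivAt_iff_isLittleO_nhds_zero]
      refine Asymptotics.IsBigO.trans_isLittleO (g := fun h => ‖h‖ ^ 2) ?_ ?_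
      · refine Asymptotics.IsBigO.of_bound (1 / (2 * radius K ^ 2)) (.of_forall fun h => ?_)
        have h1 := Real.one_sub_sq_div_two_le_cos (x := ‖h‖ / radius K)
        have h2 := Real.cos_le_one (‖h‖ / radius K)
        simp only [zero_add, norm_zero, zero_div, Real.cos_zero, zero_apply,
          sub_zero]
        rw [Real.norm_eq_abs, abs_of_nonpos (by linarith), norm_pow, norm_norm]
        calc -(Real.cos (‖h‖ / radius K) - 1) ≤ (‖h‖ / radius K) ^ 2 / 2 := by linarith
          _ = _ := by field_simp
      · exact Asymptotics.isLittleO_norm_pow_id one_lt_two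
    have hsinc : HasFDerivAt (fun v => Real.sinc (‖v‖ / radius K) • T v)
        T.toContinuousLinearMap 0 := by
      rw [hasFDerivAt_iff_isLittleO_nhds_zero]
      have hlim : (fun h : EuclideanSpace ℝ (Fin n) => Real.sinc (‖h‖ / radius K) - 1)
          =o[nhds 0] fun _ => (1 : ℝ) := by
        rw [Asymptotics.isLittleO_one_iff]
        have hcont : Continuous fun h : EuclideanSpace ℝ (Fin n) =>
            Real.sinc (‖h‖ / radius K) - 1 :=
          (Real.continuous_sinc.comp (by fun_prop)).sub continuous_const
        simpa using hcont.tendsto 0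
      have hT : (fun h : EuclideanSpace ℝ (Fin n) => T h) =O[nhds 0] fun h => h :=
        T.toContinuousLinearMap.isBigO_id _
      refine (hlim.smul_isBigO hT).congr (fun h => ?_) (fun h => one_smul _ _)
      simp [sub_smul]
    refine ((hcos.smul_const μ).add hsinc).congr_fderiv ?_
    ext1 h
    simp [wrapDeriv_apply, T]
  · have hv' : ‖v‖ ≠ 0 := norm_ne_zero_iff.2 hv
    have hnorm : HasFDerivAt (fun v : EuclideanSpace ℝ (Fin n) => ‖v‖ / radius K)
        ((radius K)⁻¹ • (1 / ‖v‖) • innerSL ℝ v) v := by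
      simpa [div_eq_inv_mul] using (hasFDerivAt_norm hv).const_mul (radius K)⁻¹
    have hcos := ((Real.hasDerivAt_cos _).comp_hasFDerivAt v hnorm).smul_const μ
    have hsinc := ((hasDerivAt_sinc (div_ne_zero hv' hR.ne')).comp_hasFDerivAt v hnorm).smul
      T.toContinuousLinearMap.hasFDerivAt
    refine (hcos.add hsinc).congr_fderiv ?_
    ext1 h
    rw [wrapDeriv_apply, Real.sinc_of_ne_zero (div_ne_zero hv' hR.ne')]
    simp only [add_apply, ContinuousLinearMap.smulRight_apply,
      smul_apply, innerSL_apply_apply, smul_eq_mul, smul_sub, smul_smul,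
      Function.comp, LinearIsometry.coe_toContinuousLinearMap]
    change _ + (_ • T h + _ • T v) = _ • T h + (_ • T v - _)
    have e1 : -Real.sin (‖v‖ / radius K) * ((radius K)⁻¹ * (1 / ‖v‖)) * inner ℝ v h =
        -(inner ℝ v h * (Real.sin (‖v‖ / radius K) / (‖v‖ / radius K) / radius K ^ 2)) := by
      field_simp
    have e2 (g : ℝ) : (Real.cos (‖v‖ / radius K) - g) / (‖v‖ / radius K) *
        ((radius K)⁻¹ * (1 / ‖v‖)) * inner ℝ v h =
        inner ℝ v h * ((Real.cos (‖v‖ / radius K) - g) / ‖v‖ ^ 2) := by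
      field_simp
    rw [e1, e2, Real.sinc_of_ne_zero (div_ne_zero hv' hR.ne')]
    module

/-- The Gauss lemma for the sampling map: its derivative preserves lengths along `v` and scales
the orthogonal complement of `v` by `sinc (‖v‖ / R)`. -/
lemma inner_wrapDeriv (hK : 0 < K) (hμ : μ ∈ hypersphere n K) (hμ0 : μ ≠ -origin n K)
    (v h k : EuclideanSpace ℝ (Fin n)) :
    inner ℝ (wrapDeriv hK hμ hμ0 v h) (wrapDeriv hK hμ hμ0 v k) =
      Real.sinc (‖v‖ / radius K) ^ 2 * inner ℝ h k +
        (1 - Real.sinc (‖v‖ / radius K) ^ 2) / ‖v‖ ^ 2 * (inner ℝ v h * inner ℝ v k) := by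
  have hR := radius_pos hK
  rcases eq_or_ne v 0 with rfl | hv
  · simp [wrapDeriv_apply]
  have hv' : ‖v‖ ≠ 0 := norm_ne_zero_iff.2 hv
  have hs : ‖v‖ * Real.sinc (‖v‖ / radius K) = radius K * Real.sin (‖v‖ / radius K) := by
    rw [← mul_sinc]; field_simp
  have hμμ : inner ℝ μ μ = radius K ^ 2 := by
    rw [real_inner_self_eq_norm_sq, norm_of_mem_hypersphere hK hμ]
  have hμT := inner_transportIsometry hK hμ hμ0
  have hTμ : ∀ w, inner ℝ (transportIsometry hK hμ hμ0 w) μ = 0 := fun w => by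
    rw [real_inner_comm]; exact hμT w
  simp only [wrapDeriv_apply, inner_add_left, inner_add_right, inner_sub_left, inner_sub_right,
    real_inner_smul_left, real_inner_smul_right, LinearIsometry.inner_map_map, hμT, hTμ, hμμ,
    real_inner_self_eq_norm_sq v, real_inner_comm v h]
  generalize Real.sinc (‖v‖ / radius K) = g at *
  have hcs := Real.sin_sq_add_cos_sq (‖v‖ / radius K)
  generalize Real.sin (‖v‖ / radius K) = s at *
  generalize Real.cos (‖v‖ / radius K) = c at *
  field_simp
  linear_combination inner ℝ v h * inner ℝ v k * radius K ^ 2 * hcs +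
    inner ℝ v h * inner ℝ v k * (g * ‖v‖ + radius K * s) * hs

lemma inner_wrap_wrapDeriv (hK : 0 < K) (hμ : μ ∈ hypersphere n K) (hμ0 : μ ≠ -origin n K)
    (v h : EuclideanSpace ℝ (Fin n)) : inner ℝ (wrap K μ v) (wrapDeriv hK hμ hμ0 v h) = 0 := by
  -- the squared norm of `wrap` is constant
  have h1 : HasFDerivAt (fun v => ‖wrap K μ v‖ ^ 2) _ v := (hasFDerivAt_wrap hK hμ hμ0 v).norm_sq
  have h2 : HasFDerivAt (fun v => ‖wrap K μ v‖ ^ 2) (0 : _ →L[ℝ] ℝ) v := by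
    simp only [fun v => norm_of_mem_hypersphere hK (wrap_mem hK hμ hμ0 v)]
    exact hasFDerivAt_const _ _
  simpa using DFunLike.congr_fun (h1.unique h2) h

lemma normDet_wrapDeriv (hn : 1 ≤ n) (hK : 0 < K) (hμ : μ ∈ hypersphere n K)
    (hμ0 : μ ≠ -origin n K) {v : EuclideanSpace ℝ (Fin n)} (hv : ‖v‖ < Real.pi * radius K) :
    (wrapDeriv hK hμ hμ0 v).toLinearMap.normDet = Real.sinc (‖v‖ / radius K) ^ (n - 1) := by
  have hR := radius_pos hK
  refine normDet_eq_pow hn _ (sinc_pos (by positivity) ((div_lt_iff₀ hR).2 hv)) v ?_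
    (inner_wrapDeriv hK hμ hμ0 v)
  rcases eq_or_ne v 0 with rfl | hv0
  · simp
  · field_simp
    ring

lemma jacobian_eq (hn : 1 ≤ n) (hK : 0 < K) (hμ : μ ∈ hypersphere n K) (hμ0 : μ ≠ -origin n K)
    {v : EuclideanSpace ℝ (Fin n)} (hv : ‖v‖ < Real.pi * radius K) :
    jacobian K μ v = Real.sinc (‖v‖ / radius K) ^ (n - 1) := by
  rw [jacobian, (hasFDerivAt_wrap hK hμ hμ0 v).fderiv, normDet_wrapDeriv hn hK hμ hμ0 hv]

end Derivative

end WrappedNormal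

namespace WrappedNormal

/-! ### Density of the multivariate normal distribution -/

section Gaussian

variable {n : ℕ}

/-- The standard Gaussian has density `(2 π) ^ (-n / 2) exp (-‖v‖² / 2)`, by uniqueness of
characteristic functions. -/
lemma stdGaussian_eq_withDensity :
    stdGaussian (EuclideanSpace ℝ (Fin n)) = volume.withDensity fun v =>
      ENNReal.ofReal ((√((2 * Real.pi) ^ n))⁻¹ * Real.exp (-‖v‖ ^ 2 / 2)) := by
  have hpow : ((2 * Real.pi : ℝ)) ^ ((n : ℝ) / 2) = √((2 * Real.pi) ^ n) := by
    rw [Real.sqrt_eq_rpow, ← Real.rpow_natCast, ← Real.rpow_mul (by positivity)]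
    congr 1
    ring
  have hsq : 0 < √((2 * Real.pi) ^ n) := Real.sqrt_pos.2 (by positivity)
  have hmeas : Measurable fun v : EuclideanSpace ℝ (Fin n) =>
      (√((2 * Real.pi) ^ n))⁻¹ * Real.exp (-‖v‖ ^ 2 / 2) := by fun_prop
  have hchar (t : EuclideanSpace ℝ (Fin n)) :
      ∫ v : EuclideanSpace ℝ (Fin n), Complex.exp (-(1 / 2 : ℂ) * ‖v‖ ^ 2 +
        Complex.I * (inner ℝ t v : ℝ)) = √((2 * Real.pi) ^ n) * Complex.exp (-‖t‖ ^ 2 / 2) := by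
    rw [GaussianFourier.integral_cexp_neg_mul_sq_norm_add (by norm_num), ← hpow,
      Complex.ofReal_cpow (by positivity)]
    congr 2
    · push_cast; ring
    · simp
    · simp only [Complex.I_sq]; ring
  have hint : Integrable fun v : EuclideanSpace ℝ (Fin n) =>
      (√((2 * Real.pi) ^ n))⁻¹ * Real.exp (-‖v‖ ^ 2 / 2) := by
    have h := (GaussianFourier.integrable_cexp_neg_mul_sq_norm_add (V := EuclideanSpace ℝ (Fin n))
      (b := 1 / 2) (by norm_num) 0 0).re.const_mul (√((2 * Real.pi) ^ n))⁻¹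
    refine h.congr (.of_forall fun v => ?_)
    have : (-(1 / 2 : ℂ) * ‖v‖ ^ 2 + 0 * (inner ℝ (0 : EuclideanSpace ℝ (Fin n)) v : ℝ)) =
        ((-‖v‖ ^ 2 / 2 : ℝ) : ℂ) := by push_cast; ring
    simp only [this, ← Complex.ofReal_exp, RCLike.re_to_complex, Complex.ofReal_re]
  have hfin : IsFiniteMeasure ((volume : Measure (EuclideanSpace ℝ (Fin n))).withDensity fun v =>
      ENNReal.ofReal ((√((2 * Real.pi) ^ n))⁻¹ * Real.exp (-‖v‖ ^ 2 / 2))) :=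
    isFiniteMeasure_withDensity_ofReal hint.2
  refine Measure.ext_of_charFun (funext fun t => ?_)
  rw [charFun_stdGaussian, charFun_apply, integral_withDensity_eq_integral_toReal_smul
    hmeas.ennreal_ofReal (.of_forall fun _ => ENNReal.ofReal_lt_top)]
  have hcongr : ∀ v : EuclideanSpace ℝ (Fin n),
      (ENNReal.ofReal ((√((2 * Real.pi) ^ n))⁻¹ * Real.exp (-‖v‖ ^ 2 / 2))).toReal •
        Complex.exp ((inner ℝ v t : ℝ) * Complex.I) =
      ((√((2 * Real.pi) ^ n))⁻¹ : ℝ) * Complex.exp (-(1 / 2 : ℂ) * ‖v‖ ^ 2 +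
        Complex.I * (inner ℝ t v : ℝ)) := fun v => by
    rw [ENNReal.toReal_ofReal (by positivity), Complex.real_smul, Complex.ofReal_mul, mul_assoc,
      Complex.ofReal_exp, ← Complex.exp_add, real_inner_comm]
    congr 2
    push_cast
    ring
  simp only [hcongr]
  rw [integral_const_mul, hchar, ← mul_assoc, ← Complex.ofReal_mul, inv_mul_cancel₀ hsq.ne',
    Complex.ofReal_one, one_mul]

lemma measurable_normalDensity (S : Matrix (Fin n) (Fin n) ℝ) : Measurable (normalDensity S) := by
  unfold normalDensity dotProduct Matrix.mulVec dotProduct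
  fun_prop

open scoped MatrixOrder Matrix in
/-- The centred normal distribution is the image of the standard one under `Σ^(1/2)`, so that
its density follows by a linear change of variables. -/
lemma multivariateGaussian_eq_withDensity {S : Matrix (Fin n) (Fin n) ℝ} (hS : S.PosDef) :
    multivariateGaussian 0 S = volume.withDensity fun v => ENNReal.ofReal (normalDensity S v) := by
  set A := CFC.sqrt S with hA
  have hAA : A * A = S := CFC.sqrt_mul_sqrt_self S hS.posSemidef.nonneg
  have hAT : Aᵀ = A := (CFC.sqrt_nonneg S).isSelfAdjoint
  have hdet : A.det * A.det = S.det := by rw [← Matrix.det_mul, hAA]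
  have hSdet := hS.det_pos
  have hA0 : A.det ≠ 0 := fun h => by simp [h] at hdet; linarith
  set L := Matrix.toEuclideanCLM (𝕜 := ℝ) A with hL
  have hLdet : LinearMap.det (L : EuclideanSpace ℝ (Fin n) →ₗ[ℝ] EuclideanSpace ℝ (Fin n)) =
      A.det := by
    rw [hL, Matrix.coe_toEuclideanCLM_eq_toEuclideanLin, Matrix.toEuclideanLin_eq_toLin_orthonormal,
      LinearMap.det_toLin]
  have hLv : ∀ v, (L v).ofLp = A.mulVec v.ofLp := fun v => by
    simp [hL]
  have hpos : 0 < √((2 * Real.pi) ^ n) := Real.sqrt_pos.2 (by positivity)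
  have hstd : ∀ v, normalDensity S (L v) * |A.det| =
      (√((2 * Real.pi) ^ n))⁻¹ * Real.exp (-‖v‖ ^ 2 / 2) := fun v => by
    have hq : (L v).ofLp ⬝ᵥ (S⁻¹).mulVec (L v).ofLp = ‖v‖ ^ 2 := by
      rw [hLv, ← hAA, Matrix.mul_inv_rev, Matrix.mulVec_mulVec, Matrix.mul_assoc,
        Matrix.nonsing_inv_mul A (isUnit_iff_ne_zero.2 hA0), Matrix.mul_one,
        Matrix.dotProduct_mulVec, ← Matrix.mulVec_transpose, Matrix.transpose_nonsing_inv, hAT,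
        Matrix.mulVec_mulVec, Matrix.nonsing_inv_mul A (isUnit_iff_ne_zero.2 hA0),
        Matrix.one_mulVec, EuclideanSpace.real_norm_sq_eq]
      simp [dotProduct, sq]
    have hdet' : √S.det = |A.det| := by rw [← hdet, Real.sqrt_mul_self_eq_abs]
    rw [normalDensity, hq, Real.sqrt_mul (by positivity), hdet']
    have := abs_pos.2 hA0
    field_simp
  ext s hs
  have hLm : Measurable L := by fun_prop
  rw [multivariateGaussian, ← hA, ← hL]
  simp only [zero_add]
  rw [Measure.map_apply hLm hs, stdGaussian_eq_withDensity, withDensity_apply _ (hLm hs),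
    withDensity_apply _ hs]
  have hmap := Measure.map_linearMap_addHaar_eq_smul_addHaar
    (volume : Measure (EuclideanSpace ℝ (Fin n))) (hLdet ▸ hA0)
  have hvol : (volume : Measure (EuclideanSpace ℝ (Fin n))) =
      ENNReal.ofReal |A.det| • volume.map L := by
    have hmap' : volume.map L = ENNReal.ofReal |A.det⁻¹| •
        (volume : Measure (EuclideanSpace ℝ (Fin n))) := hLdet ▸ hmap
    rw [hmap', smul_smul, ← ENNReal.ofReal_mul (abs_nonneg _), ← abs_mul, mul_inv_cancel₀ hA0,
      abs_one, ENNReal.ofReal_one, one_smul]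
  conv_rhs => rw [hvol]
  rw [Measure.restrict_smul, lintegral_smul_measure, setLIntegral_map hs
    (measurable_normalDensity S).ennreal_ofReal hLm, smul_eq_mul, ← lintegral_const_mul' _ _
    ENNReal.ofReal_ne_top]
  refine lintegral_congr fun v => ?_
  rw [← hstd, mul_comm, ENNReal.ofReal_mul (abs_nonneg _)]

end Gaussian

end WrappedNormal

namespace WrappedNormal

/-! ### Surface measure in geodesic polar coordinates -/

section Surface

variable {n : ℕ}

/-- If `p` is a unit vector orthogonal to the range of `g`, the map `h ↦ h₀ p + c g (h₁, …, hₙ)`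
has determinant `cⁿ` times that of `g`. -/
lemma normDet_cons {V : Type*} [NormedAddCommGroup V] [InnerProductSpace ℝ V]
    (f : EuclideanSpace ℝ (Fin (n + 1)) →ₗ[ℝ] V) (g : EuclideanSpace ℝ (Fin n) →ₗ[ℝ] V) {p : V}
    (hp : ‖p‖ = 1) {c : ℝ} (hc : 0 ≤ c) (hf : ∀ h, f h = h 0 • p + c • g (tangentCoords h))
    (hpg : ∀ h, inner ℝ p (g h) = 0) : f.normDet = c ^ n * g.normDet := by
  have h0 : tangentCoords (EuclideanSpace.single (0 : Fin (n + 1)) (1 : ℝ)) = 0 := by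
    ext i; simp [tangentCoords]
  have hs (i : Fin n) : tangentCoords (EuclideanSpace.single i.succ (1 : ℝ)) =
      EuclideanSpace.single i 1 := by
    ext j; simp [tangentCoords]
  have hf0 : f (EuclideanSpace.basisFun (Fin (n + 1)) ℝ 0) = p := by
    simp [hf, h0]
  have hfs (i : Fin n) : f (EuclideanSpace.basisFun (Fin (n + 1)) ℝ i.succ) =
      c • g (EuclideanSpace.basisFun (Fin n) ℝ i) := by
    simp [hf, hs]
  have hsub : (Matrix.gram ℝ (f <| EuclideanSpace.basisFun (Fin (n + 1)) ℝ ·)).submatrix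
      Fin.succ Fin.succ = (c ^ 2) • Matrix.gram ℝ (g <| EuclideanSpace.basisFun (Fin n) ℝ ·) := by
    ext i j
    simp only [Matrix.submatrix_apply, Matrix.gram_apply, hfs, Matrix.smul_apply,
      real_inner_smul_left, real_inner_smul_right, smul_eq_mul]
    ring
  have h1 := f.normDet_sq_eq_det_gram (EuclideanSpace.basisFun (Fin (n + 1)) ℝ)
  have h2 := g.normDet_sq_eq_det_gram (EuclideanSpace.basisFun (Fin n) ℝ)
  simp only [RCLike.ofReal_real_eq_id, id] at h1 h2
  refine (sq_eq_sq₀ f.normDet_nonneg (mul_nonneg (pow_nonneg hc n) g.normDet_nonneg)).1 ?_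
  rw [h1, Matrix.det_succ_row_zero, Fin.sum_univ_succ, Finset.sum_eq_zero, add_zero, mul_pow, h2]
  · rw [Fin.succAbove_zero, hsub, Matrix.det_smul, Matrix.gram_apply, hf0,
      real_inner_self_eq_norm_sq, hp]
    simp only [Fin.val_zero, pow_zero, one_pow, one_mul, Fintype.card_fin]
    ring
  · intro i _
    rw [Matrix.gram_apply, hf0, hfs, real_inner_smul_right, hpg]
    simp

/-- `tangentCoords` as a continuous linear map. -/
noncomputable def tangentCoordsL :
    EuclideanSpace ℝ (Fin (n + 1)) →L[ℝ] EuclideanSpace ℝ (Fin n) :=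
  LinearMap.toContinuousLinearMap
    { toFun := tangentCoords
      map_add' := fun v w => by ext i; simp [tangentCoords]
      map_smul' := fun c v => by ext i; simp [tangentCoords] }

/-- Splitting off the first coordinate identifies `ℝⁿ⁺¹` with `ℝ × ℝⁿ`. -/
lemma measurePreserving_split :
    MeasurePreserving fun x : EuclideanSpace ℝ (Fin (n + 1)) => (x 0, tangentCoords x) :=
  ((MeasurePreserving.id volume).prod (PiLp.volume_preserving_toLp (Fin n))).comp
    ((volume_preserving_piFinSuccAbove (fun _ => ℝ) 0).comp
      (PiLp.volume_preserving_ofLp (Fin (n + 1))))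

/-- The part over the height interval `(0, 1)` of the cylinder with base `B ⊆ ℝⁿ`. -/
def cylinder (B : Set (EuclideanSpace ℝ (Fin n))) : Set (EuclideanSpace ℝ (Fin (n + 1))) :=
  (fun x => (x 0, tangentCoords x)) ⁻¹' (Set.Ioo 0 1 ×ˢ B)

lemma lintegral_Ioo_pow : ∫⁻ t in Set.Ioo (0 : ℝ) 1, ENNReal.ofReal (t ^ n) =
    ENNReal.ofReal (1 / (n + 1)) := by
  rw [setLIntegral_congr Ioo_ae_eq_Ioc, ← ofReal_integral_eq_lintegral_ofReal
    (intervalIntegral.intervalIntegrable_pow _).1, ← intervalIntegral.integral_of_le zero_le_one]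
  · simp
  · filter_upwards [ae_restrict_mem measurableSet_Ioc] with y hy
    exact pow_nonneg hy.1.le _

lemma lintegral_cylinder {B : Set (EuclideanSpace ℝ (Fin n))} (hB : MeasurableSet B)
    {φ : EuclideanSpace ℝ (Fin n) → ENNReal} (hφ : Measurable φ) :
    ∫⁻ x in cylinder B, ENNReal.ofReal (x 0 ^ n) * φ (tangentCoords x) =
      ENNReal.ofReal (1 / (n + 1)) * ∫⁻ v in B, φ v := by
  have hpow : Measurable fun t : ℝ => ENNReal.ofReal (t ^ n) := by fun_prop
  have h := (measurePreserving_split (n := n)).setLIntegral_comp_preimage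
    (measurableSet_Ioo.prod hB : MeasurableSet (Set.Ioo (0 : ℝ) 1 ×ˢ B))
    (f := fun q => ENNReal.ofReal (q.1 ^ n) * φ q.2)
    ((hpow.comp measurable_fst).mul (hφ.comp measurable_snd))
  rw [cylinder, h, Measure.volume_eq_prod, ← Measure.prod_restrict,
    lintegral_prod_mul hpow.aemeasurable hφ.aemeasurable, lintegral_Ioo_pow]

variable {K : ℝ} {μ : EuclideanSpace ℝ (Fin (n + 1))}

/-- The cone over the sampling map: `(t, v)` goes to the point of norm `t` (for `t ≥ 0`) in the
direction of `wrap v`. -/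
noncomputable def cone (K : ℝ) (μ x : EuclideanSpace ℝ (Fin (n + 1))) :
    EuclideanSpace ℝ (Fin (n + 1)) :=
  x 0 • (radius K)⁻¹ • wrap K μ (tangentCoords x)

/-- The derivative of `cone`. -/
noncomputable def coneDeriv (hK : 0 < K) (hμ : μ ∈ hypersphere n K) (hμ0 : μ ≠ -origin n K)
    (x : EuclideanSpace ℝ (Fin (n + 1))) :
    EuclideanSpace ℝ (Fin (n + 1)) →L[ℝ] EuclideanSpace ℝ (Fin (n + 1)) :=
  x 0 • (radius K)⁻¹ • (wrapDeriv hK hμ hμ0 (tangentCoords x)).comp tangentCoordsL +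
    (EuclideanSpace.proj (0 : Fin (n + 1)) : EuclideanSpace ℝ (Fin (n + 1)) →L[ℝ] ℝ).smulRight
      ((radius K)⁻¹ • wrap K μ (tangentCoords x))

lemma hasFDerivAt_cone (hK : 0 < K) (hμ : μ ∈ hypersphere n K) (hμ0 : μ ≠ -origin n K)
    (x : EuclideanSpace ℝ (Fin (n + 1))) :
    HasFDerivAt (cone K μ) (coneDeriv hK hμ hμ0 x) x := by
  have h0 : HasFDerivAt (fun x : EuclideanSpace ℝ (Fin (n + 1)) => x 0)
      (EuclideanSpace.proj (0 : Fin (n + 1)) : EuclideanSpace ℝ (Fin (n + 1)) →L[ℝ] ℝ) x :=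
    (EuclideanSpace.proj (0 : Fin (n + 1)) :
      EuclideanSpace ℝ (Fin (n + 1)) →L[ℝ] ℝ).hasFDerivAt
  have hw : HasFDerivAt (fun x => wrap K μ (tangentCoords x))
      ((wrapDeriv hK hμ hμ0 (tangentCoords x)).comp tangentCoordsL) x :=
    (hasFDerivAt_wrap hK hμ hμ0 (tangentCoords x)).comp x (tangentCoordsL (n := n)).hasFDerivAt
  exact h0.smul (hw.const_smul (radius K)⁻¹)

lemma norm_inv_radius_smul (hK : 0 < K) {z : EuclideanSpace ℝ (Fin (n + 1))}
    (hz : z ∈ hypersphere n K) : ‖(radius K)⁻¹ • z‖ = 1 := by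
  have hR := radius_pos hK
  rw [norm_smul, norm_of_mem_hypersphere hK hz, norm_inv, Real.norm_of_nonneg hR.le,
    inv_mul_cancel₀ hR.ne']

lemma abs_det_coneDeriv (hn : 1 ≤ n) (hK : 0 < K) (hμ : μ ∈ hypersphere n K)
    (hμ0 : μ ≠ -origin n K) {x : EuclideanSpace ℝ (Fin (n + 1))} (hx : 0 ≤ x 0)
    (hv : ‖tangentCoords x‖ < Real.pi * radius K) :
    |(coneDeriv hK hμ hμ0 x).det| = (x 0 * (radius K)⁻¹) ^ n *
      Real.sinc (‖tangentCoords x‖ / radius K) ^ (n - 1) := by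
  have hR := radius_pos hK
  rw [ContinuousLinearMap.det, ← LinearMap.normDet_eq_abs_det,
    ← normDet_wrapDeriv hn hK hμ hμ0 hv]
  refine normDet_cons _ _ (norm_inv_radius_smul hK (wrap_mem hK hμ hμ0 (tangentCoords x)))
    (by positivity) (fun h => ?_) fun h => ?_
  · rw [mul_smul]
    exact add_comm
      (x 0 • (radius K)⁻¹ • wrapDeriv hK hμ hμ0 (tangentCoords x) (tangentCoords h)) _
  · rw [real_inner_smul_left]
    exact mul_eq_zero_of_right _ (inner_wrap_wrapDeriv hK hμ hμ0 _ h)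

lemma continuous_wrap (hK : 0 < K) (hμ : μ ∈ hypersphere n K) (hμ0 : μ ≠ -origin n K) :
    Continuous (wrap K μ) :=
  continuous_iff_continuousAt.2 fun v => (hasFDerivAt_wrap hK hμ hμ0 v).continuousAt

lemma injOn_cone (hK : 0 < K) (hμ : μ ∈ hypersphere n K) (hμ0 : μ ≠ -origin n K) :
    Set.InjOn (cone K μ) (cylinder (Metric.ball 0 (Real.pi * radius K))) := by
  rintro x ⟨hx0, hx⟩ y ⟨hy0, hy⟩ hxy
  simp only [mem_ball_zero_iff] at hx hy
  have hx1 := norm_inv_radius_smul hK (wrap_mem hK hμ hμ0 (tangentCoords x))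
  have hy1 := norm_inv_radius_smul hK (wrap_mem hK hμ hμ0 (tangentCoords y))
  -- `wrap v / R` is a unit vector, so the norm recovers the height and `unwrap` the base point
  have h0 : x 0 = y 0 := by
    have h := congrArg norm hxy
    rwa [cone, cone, norm_smul (x 0), norm_smul (y 0), hx1, hy1, mul_one, mul_one,
      Real.norm_of_nonneg hx0.1.le, Real.norm_of_nonneg hy0.1.le] at h
  rw [cone, cone, h0] at hxy
  have hw := smul_right_injective _ (inv_ne_zero (radius_pos hK).ne')
    (smul_right_injective _ hy0.1.ne' hxy)
  have ht : tangentCoords x = tangentCoords y := by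
    rw [← unwrap_wrap hK hμ hμ0 hx, hw, unwrap_wrap hK hμ hμ0 hy]
  ext i
  refine Fin.cases h0 (fun i => ?_) i
  exact congrArg (fun v : EuclideanSpace ℝ (Fin n) => v i) ht

open scoped Pointwise in
/-- The solid cone over a subset `A` of the hypersphere is, up to part of the ray through `-μ`,
the image under `cone` of the cylinder over the preimage of `A`. -/
lemma volume_cone (hn : 1 ≤ n) (hK : 0 < K) (hμ : μ ∈ hypersphere n K) (hμ0 : μ ≠ -origin n K)
    (A : Set (EuclideanSpace ℝ (Fin (n + 1)))) :
    volume (Set.Ioo (0 : ℝ) 1 • ((↑) '' ((fun x : Metric.sphere (0 : EuclideanSpace ℝ (Fin (n + 1))) 1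
      => radius K • (x : EuclideanSpace ℝ (Fin (n + 1)))) ⁻¹' A) :
        Set (EuclideanSpace ℝ (Fin (n + 1))))) =
    volume (cone K μ '' cylinder (Metric.ball 0 (Real.pi * radius K) ∩ wrap K μ ⁻¹' A)) := by
  have hR := radius_pos hK
  refine le_antisymm ?_ (measure_mono ?_)
  · have hnull : volume (Submodule.span ℝ {μ} : Set (EuclideanSpace ℝ (Fin (n + 1)))) = 0 := by
      refine Measure.addHaar_submodule _ _ fun h => ?_
      have h1 := finrank_span_le_card (R := ℝ) ({μ} : Set (EuclideanSpace ℝ (Fin (n + 1))))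
      rw [h, finrank_top, finrank_euclideanSpace_fin] at h1
      simp at h1
      omega
    calc _ ≤ volume (cone K μ '' cylinder (Metric.ball 0 (Real.pi * radius K) ∩ wrap K μ ⁻¹' A) ∪
          (Submodule.span ℝ {μ} : Set (EuclideanSpace ℝ (Fin (n + 1))))) := measure_mono ?_
      _ ≤ _ := (measure_union_le _ _).trans (by rw [hnull, add_zero])
    rintro _ ⟨t, ht, _, ⟨y, hy, rfl⟩, rfl⟩
    have hz : radius K • (y : EuclideanSpace ℝ (Fin (n + 1))) ∈ hypersphere n K := by
      rw [mem_hypersphere_iff_norm hK, norm_smul, Real.norm_of_nonneg hR.le, norm_eq_of_mem_sphere,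
        mul_one]
    have hyz : (y : EuclideanSpace ℝ (Fin (n + 1))) = (radius K)⁻¹ • radius K • y.1 :=
      (inv_smul_smul₀ hR.ne' _).symm
    rcases eq_or_ne (radius K • (y : EuclideanSpace ℝ (Fin (n + 1)))) (-μ) with hneg | hneg
    · right
      change t • (y : EuclideanSpace ℝ (Fin (n + 1))) ∈ _
      rw [hyz, hneg]
      exact Submodule.smul_mem _ _ (Submodule.smul_mem _ _
        (Submodule.neg_mem _ (Submodule.mem_span_singleton_self μ)))
    · left
      have hw := wrap_unwrap hK hμ hμ0 hz hneg
      set v := unwrap K μ (radius K • (y : EuclideanSpace ℝ (Fin (n + 1)))) with hv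
      have htail : tangentCoords (WithLp.toLp 2 (Fin.cons t v.ofLp) :
          EuclideanSpace ℝ (Fin (n + 1))) = v := by
        ext i; simp [tangentCoords]
      refine ⟨WithLp.toLp 2 (Fin.cons t v.ofLp), ⟨by simpa using ht, ?_⟩, ?_⟩
      · change tangentCoords _ ∈ _
        rw [htail]
        refine ⟨mem_ball_zero_iff.2 (norm_unwrap_lt hK hμ hμ0 hz hneg), ?_⟩
        change wrap K μ v ∈ A
        rw [hw]
        exact hy
      · rw [cone, htail, hw, inv_smul_smul₀ hR.ne']
        rfl
  · rintro _ ⟨x, ⟨hx0, -, hxA⟩, rfl⟩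
    refine ⟨x 0, hx0, _, ⟨⟨(radius K)⁻¹ • wrap K μ (tangentCoords x), ?_⟩, ?_, rfl⟩, rfl⟩
    · rw [mem_sphere_zero_iff_norm]
      exact norm_inv_radius_smul hK (wrap_mem hK hμ hμ0 _)
    · change radius K • (radius K)⁻¹ • wrap K μ (tangentCoords x) ∈ A
      rw [smul_inv_smul₀ hR.ne']
      exact hxA

/-- The surface measure in the coordinates given by the sampling map: it has density
`sinc (‖v‖ / R) ^ (n - 1)` on the ball of radius `π R`. -/
lemma surfaceMeasure_eq_map (hn : 1 ≤ n) (hK : 0 < K) (hμ : μ ∈ hypersphere n K)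
    (hμ0 : μ ≠ -origin n K) :
    surfaceMeasure n K = ((volume.restrict (Metric.ball 0 (Real.pi * radius K))).withDensity
      fun v => ENNReal.ofReal (Real.sinc (‖v‖ / radius K) ^ (n - 1))).map (wrap K μ) := by
  have hR := radius_pos hK
  ext A hA
  have hw : Measurable (wrap K μ) := (continuous_wrap hK hμ hμ0).measurable
  have hB : MeasurableSet (Metric.ball 0 (Real.pi * radius K) ∩ wrap K μ ⁻¹' A) :=
    measurableSet_ball.inter (hw hA)
  have hC : MeasurableSet (cylinder (Metric.ball 0 (Real.pi * radius K) ∩ wrap K μ ⁻¹' A)) :=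
    measurePreserving_split.measurable (measurableSet_Ioo.prod hB)
  have hg : Measurable fun x : Metric.sphere (0 : EuclideanSpace ℝ (Fin (n + 1))) 1 =>
    radius K • (x : EuclideanSpace ℝ (Fin (n + 1))) := by fun_prop
  have hφ : Measurable fun v : EuclideanSpace ℝ (Fin n) =>
      ENNReal.ofReal (Real.sinc (‖v‖ / radius K) ^ (n - 1)) :=
    ((Real.continuous_sinc.comp (by fun_prop : Continuous fun v : EuclideanSpace ℝ (Fin n) =>
      ‖v‖ / radius K)).pow _).measurable.ennreal_ofReal
  have hvol : volume (cone K μ '' cylinder (Metric.ball 0 (Real.pi * radius K) ∩ wrap K μ ⁻¹' A)) =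
      ENNReal.ofReal ((radius K)⁻¹ ^ n * (1 / (n + 1))) *
        ∫⁻ v in Metric.ball 0 (Real.pi * radius K) ∩ wrap K μ ⁻¹' A,
          ENNReal.ofReal (Real.sinc (‖v‖ / radius K) ^ (n - 1)) := by
    rw [← lintegral_abs_det_fderiv_eq_addHaar_image volume hC
      (fun x _ => (hasFDerivAt_cone hK hμ hμ0 x).hasFDerivWithinAt)
      ((injOn_cone hK hμ hμ0).mono (Set.preimage_mono (Set.prod_mono_right Set.inter_subset_left))),
      ENNReal.ofReal_mul (by positivity), mul_assoc, ← lintegral_cylinder hB hφ,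
      ← lintegral_const_mul' _ _ ENNReal.ofReal_ne_top]
    refine setLIntegral_congr_fun hC fun x hx => ?_
    have hx0 : 0 ≤ x 0 := hx.1.1.le
    change ENNReal.ofReal |(coneDeriv hK hμ hμ0 x).det| = _
    rw [abs_det_coneDeriv hn hK hμ hμ0 hx0 (mem_ball_zero_iff.1 hx.2.1), mul_pow,
      mul_comm (x 0 ^ n), mul_assoc, ENNReal.ofReal_mul (by positivity),
      ENNReal.ofReal_mul (by positivity)]
  rw [surfaceMeasure, Measure.smul_apply, Measure.map_apply hg hA,
    Measure.toSphere_apply' _ (hg hA), volume_cone hn hK hμ hμ0, hvol, Measure.map_apply hw hA,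
    withDensity_apply _ (hw hA), Measure.restrict_restrict (hw hA), Set.inter_comm, smul_eq_mul,
    ← mul_assoc, ← mul_assoc, finrank_euclideanSpace_fin, ← ENNReal.ofReal_natCast,
    ← ENNReal.ofReal_mul (by positivity), ← ENNReal.ofReal_mul (by positivity)]
  -- `R ^ n` rescales the unit sphere and `n + 1` normalizes `toSphere`; both cancel
  have hone : radius K ^ n * ((n + 1 : ℕ) : ℝ) * ((radius K)⁻¹ ^ n * (1 / (n + 1))) = 1 := by
    rw [inv_pow]
    push_cast
    field_simp
  rw [hone, ENNReal.ofReal_one, one_mul]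

end Surface

end WrappedNormal

namespace WrappedNormal

/-! ### Density of the wrapped normal distribution -/

section Density

variable {n : ℕ} {K : ℝ} {μ z : EuclideanSpace ℝ (Fin (n + 1))} {S : Matrix (Fin n) (Fin n) ℝ}

lemma normalDensity_pos (hS : S.PosDef) (v : EuclideanSpace ℝ (Fin n)) :
    0 < normalDensity S v := by
  have := hS.det_pos
  unfold normalDensity
  positivity

lemma measurable_unwrap (K : ℝ) (μ : EuclideanSpace ℝ (Fin (n + 1))) :
    Measurable (unwrap K μ) := by
  refine (tangentCoordsL (n := n)).continuous.measurable.comp ?_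
  unfold transport logMap
  fun_prop

lemma density_eq (hn : 1 ≤ n) (hK : 0 < K) (hμ : μ ∈ hypersphere n K) (hμ0 : μ ≠ -origin n K)
    (hz : z ∈ hypersphere n K) (hzμ : z ≠ -μ) :
    density K μ S z =
      normalDensity S (unwrap K μ z) / Real.sinc (‖unwrap K μ z‖ / radius K) ^ (n - 1) := by
  rw [density, jacobian_eq hn hK hμ hμ0 (norm_unwrap_lt hK hμ hμ0 hz hzμ)]

lemma ae_surfaceMeasure (hn : 1 ≤ n) (hK : 0 < K) (hμ : μ ∈ hypersphere n K)
    (hμ0 : μ ≠ -origin n K) : ∀ᵐ z ∂surfaceMeasure n K, z ∈ hypersphere n K ∧ z ≠ -μ := by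
  have hsphere : hypersphere n K = Metric.sphere 0 (radius K) := by
    ext x
    rw [mem_hypersphere_iff_norm hK, mem_sphere_zero_iff_norm]
  have hmeas : MeasurableSet {z | z ∈ hypersphere n K ∧ z ≠ -μ} :=
    (hsphere ▸ Metric.isClosed_sphere.measurableSet).inter (measurableSet_singleton (-μ)).compl
  rw [surfaceMeasure_eq_map hn hK hμ hμ0,
    ae_map_iff (continuous_wrap hK hμ hμ0).aemeasurable hmeas]
  refine (withDensity_absolutelyContinuous _ _).ae_le ?_
  filter_upwards [ae_restrict_mem measurableSet_ball] with v hv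
  exact ⟨wrap_mem hK hμ hμ0 v, wrap_ne_neg hK hμ hμ0 (mem_ball_zero_iff.1 hv)⟩

lemma principalLaw_eq_withDensity (hn : 1 ≤ n) (hK : 0 < K) (hS : S.PosDef)
    (hμ : μ ∈ hypersphere n K) (hμ0 : μ ≠ -origin n K) :
    principalLaw K μ S =
      (surfaceMeasure n K).withDensity fun z => ENNReal.ofReal (density K μ S z) := by
  have hR := radius_pos hK
  have hw : Measurable (wrap K μ) := (continuous_wrap hK hμ hμ0).measurable
  have hsinc : Measurable fun v : EuclideanSpace ℝ (Fin n) =>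
      Real.sinc (‖v‖ / radius K) ^ (n - 1) :=
    ((Real.continuous_sinc.comp (by fun_prop : Continuous fun v : EuclideanSpace ℝ (Fin n) =>
      ‖v‖ / radius K)).pow _).measurable
  have hmeas : Measurable fun z => ENNReal.ofReal (normalDensity S (unwrap K μ z) /
      Real.sinc (‖unwrap K μ z‖ / radius K) ^ (n - 1)) :=
    (((measurable_normalDensity S).comp (measurable_unwrap K μ)).div
      (hsinc.comp (measurable_unwrap K μ))).ennreal_ofReal
  have hcomp : Measurable fun v => ENNReal.ofReal (normalDensity S (unwrap K μ (wrap K μ v)) /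
      Real.sinc (‖unwrap K μ (wrap K μ v)‖ / radius K) ^ (n - 1)) := hmeas.comp hw
  rw [withDensity_congr_ae (g := fun z => ENNReal.ofReal (normalDensity S (unwrap K μ z) /
      Real.sinc (‖unwrap K μ z‖ / radius K) ^ (n - 1)))
    (by filter_upwards [ae_surfaceMeasure hn hK hμ hμ0] with z hz
        rw [density_eq hn hK hμ hμ0 hz.1 hz.2]),
    surfaceMeasure_eq_map hn hK hμ hμ0, principalLaw, multivariateGaussian_eq_withDensity hS]
  ext A hA
  rw [Measure.map_apply hw hA, withDensity_apply _ hA, setLIntegral_map hA hmeas hw,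
    setLIntegral_withDensity_eq_setLIntegral_mul _ hsinc.ennreal_ofReal hcomp (hw hA),
    restrict_withDensity measurableSet_ball, withDensity_apply _ (hw hA),
    Measure.restrict_restrict (hw hA)]
  refine setLIntegral_congr_fun ((hw hA).inter measurableSet_ball) fun v hv => ?_
  have hv' : ‖v‖ < Real.pi * radius K := mem_ball_zero_iff.1 hv.2
  have hpos := sinc_pos (t := ‖v‖ / radius K) (by positivity) ((div_lt_iff₀ hR).2 hv')
  rw [Pi.mul_apply, unwrap_wrap hK hμ hμ0 hv', ← ENNReal.ofReal_mul
    (by positivity), mul_div_cancel₀ _ (by positivity)]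

end Density

end WrappedNormal

theorem mainTheorem10 (n : ℕ) (hn : 1 ≤ n) (K : ℝ) (hK : 0 < K)
    (S : Matrix (Fin n) (Fin n) ℝ) (hS : S.PosDef)
    (μ : EuclideanSpace ℝ (Fin (n + 1))) (hμ : μ ∈ WrappedNormal.hypersphere n K)
    (hμ0 : μ ≠ -WrappedNormal.origin n K) :
    (∀ z ∈ WrappedNormal.hypersphere n K, z ≠ -μ →
      ∀ (R : ℝ) (u v : EuclideanSpace ℝ (Fin (n + 1))),
      R = 1 / √K →
      u = WrappedNormal.logMap K μ z →
      v = WrappedNormal.transport K μ (WrappedNormal.origin n K) u →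
      0 < WrappedNormal.density K μ S z ∧
      (z ≠ μ → Real.log (WrappedNormal.density K μ S z) =
        Real.log (WrappedNormal.normalDensity S (WrappedNormal.tangentCoords v)) -
          ((n : ℝ) - 1) * Real.log (R * |Real.sin (‖u‖ / R)| / ‖u‖)) ∧
      (z = μ → Real.log (WrappedNormal.density K μ S z) =
        Real.log (WrappedNormal.normalDensity S (WrappedNormal.tangentCoords v)))) ∧
    WrappedNormal.principalLaw K μ S =
      (WrappedNormal.surfaceMeasure n K).withDensity
        (fun z => ENNReal.ofReal (WrappedNormal.density K μ S z)) := by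
  have hR := WrappedNormal.radius_pos hK
  refine ⟨?_, WrappedNormal.principalLaw_eq_withDensity hn hK hS hμ hμ0⟩
  rintro z hz hzμ R u v rfl rfl rfl
  have hlt := WrappedNormal.norm_unwrap_lt hK hμ hμ0 hz hzμ
  have hN := WrappedNormal.normalDensity_pos hS (WrappedNormal.unwrap K μ z)
  have hsinc := WrappedNormal.sinc_pos
    (t := ‖WrappedNormal.unwrap K μ z‖ / WrappedNormal.radius K) (by positivity)
    ((div_lt_iff₀ hR).2 hlt)
  rw [WrappedNormal.density_eq hn hK hμ hμ0 hz hzμ]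
  refine ⟨by positivity, fun hne => ?_, fun heq => ?_⟩
  · have hlog : WrappedNormal.logMap K μ z ≠ 0 := fun h0 => hne <| by
      rw [← WrappedNormal.expMap_logMap hK hμ hz hzμ, h0, WrappedNormal.expMap_zero]
    have hu : 0 < ‖WrappedNormal.logMap K μ z‖ := norm_pos_iff.2 hlog
    rw [WrappedNormal.norm_unwrap hK hμ hμ0] at hsinc ⊢
    change _ = Real.log (WrappedNormal.normalDensity S (WrappedNormal.unwrap K μ z)) -
      ((n : ℝ) - 1) * Real.log (WrappedNormal.radius K *
        |Real.sin (‖WrappedNormal.logMap K μ z‖ / WrappedNormal.radius K)| /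
          ‖WrappedNormal.logMap K μ z‖)
    rw [Real.log_div hN.ne' (by positivity), Real.log_pow, Nat.cast_sub hn, Nat.cast_one]
    congr 3
    rw [← WrappedNormal.mul_sinc, abs_of_pos (by positivity)]
    field_simp
  · subst heq
    rw [WrappedNormal.norm_unwrap hK hμ hμ0, WrappedNormal.logMap_self hK hμ]
    simp only [norm_zero, zero_div, Real.sinc_zero, one_pow, div_one]
    rw [WrappedNormal.unwrap, WrappedNormal.logMap_self hK hμ]
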